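/- Let $G_0$ be the graph with two vertices joined by one edge labelled $a$; these two vertices are its boundary. For $n\ge 0$ let $G_{n+1}$ be obtained from $G_n$ by the Basilica replacement rules: every $b$-edge becomes an $a$-edge with the same end points; every $a$-edge $\{x,y\}$ (a loop if $x=y$) is replaced by a new vertex $m$ carrying an $a$-loop together with two $b$-edges $\{x,m\}$ and $\{y,m\}$ (a double edge if $x=y$). The two boundary vertices are kept. Let $c_{xy}$ be the number of edges joining $x$ and $y$, let $L_nf(x)=\sum_y c_{xy}(f(x)-f(y))$ be the Laplacian of $G_n$, and let $c_n(\lambda)=\det(\lambda-L_n^D)$ be the characteristic polynomial of the Dirichlet Laplacian $L_n^D$, which is $L_n$ with the rows and columns of the two boundary vertices deleted (so $c_0=1$). There is exactly one sequence of polynomials $(\gamma_n)_{n\ge0}$ in $\mathbb{R}[\lambda]$ with $\gamma_0=1$ and such that, for every $n\ge1$, $\gamma_n$ is coprime to $\gamma_k$ for every $k<n$ and $c_n=\gamma_n\prod_{k=1}^{n-1}\gamma_k^{s_{n,k}}$ for some integers $s_{n,k}\ge0$. For $n\ge2$ put $$\eta_n=\gamma_{n-1}\prod_{0\le 2j\le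 n-4}\gamma_{n-2j-3}^{2^j},\qquad \zeta_n=\frac{\gamma_n}{\eta_n}.$$ The polynomials $\gamma_n$ and $\eta_n$ are not zero, so $\zeta_n$ is a well-defined non-zero rational function. For every $n\ge4$ the (complex) roots of the rational function $\zeta_n$, that is, the zeros of its numerator in lowest terms, are precisely the roots of $\gamma_n$, and $$\zeta_n-2=\Bigl(1+\frac{2}{\zeta_{n-1}}\Bigr)\bigl(\zeta_{n-2}^2-4\bigr)$$ as an identity of rational functions of $\lambda$. The initial data are $$\zeta_2=\frac{\lambda^2-6\lambda+4}{\lambda-2},\qquad \zeta_3=\frac{\lambda^4-12\lambda^3+42\lambda^2-44\lambda+8}{\lambda^2-6\lambda+4}.$$ -/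

import Mathlib

open Polynomial

/-- A finite multigraph (loops and multiple edges allowed) whose edges carry a label `a` or `b`,
with two marked boundary vertices. `A` and `B` are the sets of `a`-edges and of `b`-edges, and an
edge is described by its pair of end points; edges are undirected, the order in this pair is an
arbitrary choice. -/
structure ABGraph where
  V : Type
  A : Type
  B : Type
  [fintypeV : Fintype V]
  [decEqV : DecidableEq V]
  [fintypeA : Fintype A]
  [decEqA : DecidableEq A]
  [fintypeB : Fintype B]
  [decEqB : DecidableEq B]
  aEnds : A → V × V
  bEnds : B → V × V
  bdry : Bool → V

attribute [instance] ABGraph.fintypeV ABGraph.decEqV ABGraph.fintypeA ABGraph.decEqA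
  ABGraph.fintypeB ABGraph.decEqB

namespace ABGraph

/-- The replacement rules: every `b`-edge becomes an `a`-edge with the same end points; every
`a`-edge `{x, y}` (a loop if `x = y`) receives a new vertex `m`, which carries an `a`-loop, and is
replaced by the two `b`-edges `{x, m}` and `{y, m}` (a double edge if `x = y`). Boundary vertices
are kept. -/
def replace (G : ABGraph) : ABGraph where
  V := G.V ⊕ G.A
  A := G.B ⊕ G.A
  B := G.A × Bool
  aEnds := Sum.elim
    (fun e => (Sum.inl (G.bEnds e).1, Sum.inl (G.bEnds e).2))
    (fun e => (Sum.inr e, Sum.inr e))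
  bEnds := fun p =>
    (Sum.inl (if p.2 then (G.aEnds p.1).2 else (G.aEnds p.1).1), Sum.inr p.1)
  bdry := fun i => Sum.inl (G.bdry i)

/-- The number `c_{xy}` of edges joining `x` and `y`. -/
def mult (G : ABGraph) (x y : G.V) : ℕ :=
  Fintype.card {e : G.A // s((G.aEnds e).1, (G.aEnds e).2) = s(x, y)} +
    Fintype.card {e : G.B // s((G.bEnds e).1, (G.bEnds e).2) = s(x, y)}

/-- The matrix of the graph Laplacian. -/
noncomputable def laplacian (G : ABGraph) : Matrix G.V G.V ℝ :=
  Matrix.diagonal (fun x => ∑ y, (G.mult x y : ℝ)) - Matrix.of (fun x y => (G.mult x y : ℝ))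

theorem laplacian_mulVec (G : ABGraph) (f : G.V → ℝ) (x : G.V) :
    (G.laplacian.mulVec f) x = ∑ y, (G.mult x y : ℝ) * (f x - f y) := by
  rw [laplacian, Matrix.sub_mulVec, Pi.sub_apply, Matrix.mulVec_diagonal]
  simp [Matrix.mulVec, dotProduct, mul_sub, Finset.sum_mul]

/-- The vertices that are not boundary vertices. -/
abbrev Interior (G : ABGraph) : Type := {x : G.V // ∀ i, x ≠ G.bdry i}

/-- The matrix of the Dirichlet Laplacian: rows and columns of boundary vertices are deleted. -/
noncomputable def dirichletLaplacian (G : ABGraph) : Matrix G.Interior G.Interior ℝ :=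
  G.laplacian.submatrix Subtype.val Subtype.val

end ABGraph

/-- The graph `G_0`: two boundary vertices joined by one `a`-edge. -/
def basilicaG0 : ABGraph where
  V := Bool
  A := Unit
  B := Empty
  aEnds := fun _ => (false, true)
  bEnds := fun e => e.elim
  bdry := id

/-- The graph `G_n`, obtained from `G_0` by applying the replacement rules `n` times. -/
def basilicaG : ℕ → ABGraph
  | 0 => basilicaG0
  | n + 1 => (basilicaG n).replace

/-- The polynomial `c_n`, that is, the characteristic polynomial `det (λ - L)` of the Dirichlet
Laplacian `L` of `G_n`. -/
noncomputable def basilicaC (n : ℕ) : ℝ[X] := (basilicaG n).dirichletLaplacian.charpoly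

/-- The defining property of the sequence `γ_n`. -/
def IsGammaSeq (γ : ℕ → ℝ[X]) : Prop :=
  γ 0 = 1 ∧ ∀ n, 1 ≤ n →
    (∀ k < n, IsCoprime (γ n) (γ k)) ∧
      ∃ s : ℕ → ℕ, basilicaC n = γ n * ∏ k ∈ Finset.Ico 1 n, γ k ^ s k

/-- `η_n = γ_{n-1} ∏_{0 ≤ 2j ≤ n-4} γ_{n-2j-3}^{2^j}`, used for `n ≥ 2`. -/
noncomputable def basilicaEta (γ : ℕ → ℝ[X]) (n : ℕ) : ℝ[X] :=
  γ (n - 1) * ∏ j ∈ (Finset.range n).filter (fun j => 2 * j + 4 ≤ n),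
    γ (n - 2 * j - 3) ^ (2 ^ j)

/-- `ζ_n = γ_n / η_n`, as an element of the field of rational functions. -/
noncomputable def basilicaZeta (γ : ℕ → ℝ[X]) (n : ℕ) : RatFunc ℝ :=
  algebraMap ℝ[X] (RatFunc ℝ) (γ n) / algebraMap ℝ[X] (RatFunc ℝ) (basilicaEta γ n)

/-- The (real or complex) number `z` is a root of the rational function `f`: in lowest terms, the
numerator vanishes at `z` and the denominator does not. -/
def RatFunc.IsRootAt (f : RatFunc ℝ) (z : ℂ) : Prop :=
  aeval z f.num = 0 ∧ aeval z f.denom ≠ 0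

/-! The vertices created by one replacement are pairwise non-adjacent, so a Schur complement removes
them all at once. With general response parameters `p`, `q` on both kinds of edges, what remains is
the previous graph with new parameters, times a power of a single pivot (`netDet_replace`). Hence
`c_n` is a product of powers of pivots.

Put z_n = `g (n + 1) / (g n * r n)`, which is ζ_{n+1} for n ≥ 2 and -ζ_2 for n = 1. The off-diagonal
parameters satisfy Q_{n+2} = Q_n / z_n and the pivots are -z_n Q_n. Comparing consecutive pivots
gives (z_{n+1} - 2) Q_{n+1} = Q_n (z_n - 4 / z_n); the quotient of two successive instances is the
recursion for ζ.

The proof runs this backwards: `IsBasilicaSystem` is a division-free recursion that implies the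
ζ-recursion (`zeta_rec`) and, from it, the pivot formula (`pivot_eq`). It remains to recognise its
solution as γ: `exists_basilicaC_eq` gives the factorization of `c_n`, and `not_both_eq_zero`,
applied at each complex λ, gives coprimality. Uniqueness follows from coprimality and monicity. -/

/-! ### Two-terminal networks and elimination of vertices. -/

section Network

variable {K : Type*} [Field K]

/-- The form of a two-terminal element with end points `e.1`, `e.2` and response matrix
`!![p, -q; -q, p]`. -/
def edgeForm {V : Type*} [DecidableEq V] (p q : K) (e : V × V) (u v : V) : K :=
  p * ((if u = e.1 then 1 else 0) * (if v = e.1 then 1 else 0) +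
      (if u = e.2 then 1 else 0) * (if v = e.2 then 1 else 0)) -
    q * ((if u = e.1 then 1 else 0) * (if v = e.2 then 1 else 0) +
      (if u = e.2 then 1 else 0) * (if v = e.1 then 1 else 0))

theorem edgeForm_one_one {V : Type*} [Fintype V] [DecidableEq V] (e : V × V) (u v : V) :
    edgeForm (1 : K) 1 e u v =
      (if u = v then ∑ y, (if s(e.1, e.2) = s(u, y) then (1 : K) else 0) else 0) -
        (if s(e.1, e.2) = s(u, v) then 1 else 0) := by
  obtain ⟨a, b⟩ := e
  have hsum : ∑ y, (if s(a, b) = s(u, y) then (1 : K) else 0) =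
      if u = a ∨ u = b then 1 else 0 := by
    by_cases h1 : u = a
    · subst h1
      have : ∀ y, s(u, b) = s(u, y) ↔ b = y := fun y => Sym2.congr_right
      simp [this]
    · by_cases h2 : u = b
      · subst h2
        have : ∀ y, s(a, u) = s(u, y) ↔ a = y := fun y => by rw [Sym2.eq_swap, Sym2.congr_right]
        simp [this]
      · have : ∀ y, ¬ s(a, b) = s(u, y) := by
          intro y; simp [Ne.symm h1, Ne.symm h2]
        simp [this, h1, h2]
  dsimp only
  rw [hsum]
  simp only [edgeForm, Sym2.eq_iff]
  by_cases h1 : u = a <;> by_cases h2 : u = b <;> by_cases h3 : v = a <;> by_cases h4 : v = b <;>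
    by_cases h5 : u = v <;> by_cases h6 : a = b <;> first | (exfalso; grind) | skip
  all_goals simp_all [eq_comm]

namespace ABGraph

/-- The matrix `t - L`, where `L` is the weighted Laplacian in which every `a`-edge is an element
with parameters `pa`, `qa` and every `b`-edge one with parameters `pb`, `qb`. -/
def netMatrix (G : ABGraph) (t pa qa pb qb : K) (u v : G.V) : K :=
  (if u = v then t else 0) - ∑ e, edgeForm pa qa (G.aEnds e) u v -
    ∑ e, edgeForm pb qb (G.bEnds e) u v

/-- The determinant of `netMatrix` restricted to the interior vertices. -/
def netDet (G : ABGraph) (t pa qa pb qb : K) : K :=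
  (Matrix.of fun u v : G.Interior => G.netMatrix t pa qa pb qb u.1 v.1).det

theorem mult_eq_sum (G : ABGraph) (u v : G.V) :
    (G.mult u v : K) =
      ∑ e, (if s((G.aEnds e).1, (G.aEnds e).2) = s(u, v) then (1 : K) else 0) +
        ∑ e, (if s((G.bEnds e).1, (G.bEnds e).2) = s(u, v) then (1 : K) else 0) := by
  simp [mult, Fintype.card_subtype]

theorem netMatrix_one (G : ABGraph) (t : K) (u v : G.V) :
    G.netMatrix t 1 1 1 1 u v =
      (if u = v then t else 0) -
        ((if u = v then ∑ y, (G.mult u y : K) else 0) - (G.mult u v : K)) := by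
  simp only [netMatrix, edgeForm_one_one, mult_eq_sum, Finset.sum_sub_distrib,
    Finset.sum_add_distrib]
  by_cases h : u = v
  · simp only [h, if_true]
    rw [Finset.sum_comm (γ := G.A), Finset.sum_comm (γ := G.B)]
    ring
  · simp only [h, if_false, Finset.sum_const_zero]
    ring

theorem netMatrix_replace_inl_inl (G : ABGraph) (t pa qa pb qb : K) (x y : G.V) :
    G.replace.netMatrix t pa qa pb qb (Sum.inl x) (Sum.inl y) =
      (if x = y then t else 0) - ∑ e, edgeForm pa qa (G.bEnds e) x y -
        ∑ e, pb * ((if x = (G.aEnds e).1 then 1 else 0) * (if y = (G.aEnds e).1 then 1 else 0) +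
          (if x = (G.aEnds e).2 then 1 else 0) * (if y = (G.aEnds e).2 then 1 else 0)) := by
  change (if (Sum.inl x : G.V ⊕ G.A) = Sum.inl y then t else 0) -
    (∑ e : G.B ⊕ G.A, edgeForm (V := G.V ⊕ G.A) pa qa (Sum.elim
      (fun e => (Sum.inl (G.bEnds e).1, Sum.inl (G.bEnds e).2))
      (fun e => (Sum.inr e, Sum.inr e)) e) (Sum.inl x) (Sum.inl y)) -
    ∑ p : G.A × Bool, edgeForm (V := G.V ⊕ G.A) pb qb
      (Sum.inl (if p.2 then (G.aEnds p.1).2 else (G.aEnds p.1).1), Sum.inr p.1)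
        (Sum.inl x) (Sum.inl y) = _
  simp only [Fintype.sum_sum_type, Fintype.sum_prod_type, Fintype.sum_bool, edgeForm]
  simp [mul_add, add_comm]

theorem netMatrix_replace_inl_inr (G : ABGraph) (t pa qa pb qb : K) (x : G.V) (m : G.A) :
    G.replace.netMatrix t pa qa pb qb (Sum.inl x) (Sum.inr m) =
      qb * ((if x = (G.aEnds m).1 then 1 else 0) + (if x = (G.aEnds m).2 then 1 else 0)) := by
  change (if (Sum.inl x : G.V ⊕ G.A) = Sum.inr m then t else 0) -
    (∑ e : G.B ⊕ G.A, edgeForm (V := G.V ⊕ G.A) pa qa (Sum.elim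
      (fun e => (Sum.inl (G.bEnds e).1, Sum.inl (G.bEnds e).2))
      (fun e => (Sum.inr e, Sum.inr e)) e) (Sum.inl x) (Sum.inr m)) -
    ∑ p : G.A × Bool, edgeForm (V := G.V ⊕ G.A) pb qb
      (Sum.inl (if p.2 then (G.aEnds p.1).2 else (G.aEnds p.1).1), Sum.inr p.1)
        (Sum.inl x) (Sum.inr m) = _
  simp only [Fintype.sum_sum_type, Fintype.sum_prod_type, Fintype.sum_bool, edgeForm]
  simp [Finset.sum_add_distrib, mul_add, add_comm]

theorem netMatrix_comm (G : ABGraph) (t pa qa pb qb : K) (u v : G.V) :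
    G.netMatrix t pa qa pb qb u v = G.netMatrix t pa qa pb qb v u := by
  have h : ∀ (p q : K) (e : G.V × G.V), edgeForm p q e u v = edgeForm p q e v u := by
    intro p q e; simp only [edgeForm]; ring
  simp only [netMatrix, h, eq_comm (a := u)]

/-- The loop at a new vertex contributes `2 * (pa - qa)` and its two `b`-edges `pb` each; distinct
new vertices share no edge. The block to be inverted is therefore scalar. -/
theorem netMatrix_replace_inr_inr (G : ABGraph) (t pa qa pb qb : K) (m m' : G.A) :
    G.replace.netMatrix t pa qa pb qb (Sum.inr m) (Sum.inr m') =
      if m = m' then t - 2 * (pa - qa) - 2 * pb else 0 := by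
  change (if (Sum.inr m : G.V ⊕ G.A) = Sum.inr m' then t else 0) -
    (∑ e : G.B ⊕ G.A, edgeForm (V := G.V ⊕ G.A) pa qa (Sum.elim
      (fun e => (Sum.inl (G.bEnds e).1, Sum.inl (G.bEnds e).2))
      (fun e => (Sum.inr e, Sum.inr e)) e) (Sum.inr m) (Sum.inr m')) -
    ∑ p : G.A × Bool, edgeForm (V := G.V ⊕ G.A) pb qb
      (Sum.inl (if p.2 then (G.aEnds p.1).2 else (G.aEnds p.1).1), Sum.inr p.1)
        (Sum.inr m) (Sum.inr m') = _
  simp only [Fintype.sum_sum_type, Fintype.sum_prod_type, Fintype.sum_bool, edgeForm]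
  by_cases h : m = m'
  · subst h
    simp [Finset.sum_add_distrib, Finset.sum_sub_distrib, ← Finset.mul_sum]
    ring
  · simp [h, Finset.sum_add_distrib, Finset.sum_sub_distrib, ← Finset.mul_sum]

/-- The interior vertices of `G.replace`. -/
def interiorReplaceEquiv (G : ABGraph) : G.Interior ⊕ G.A ≃ G.replace.Interior where
  toFun := Sum.elim (fun x => ⟨Sum.inl x.1, fun i h => x.2 i (Sum.inl_injective h)⟩)
    (fun m => ⟨Sum.inr m, fun _ h => Sum.inr_ne_inl h⟩)
  invFun x := match x with
    | ⟨Sum.inl x, hx⟩ => Sum.inl ⟨x, fun i h => hx i (congrArg Sum.inl h)⟩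
    | ⟨Sum.inr m, _⟩ => Sum.inr m
  left_inv x := by rcases x with x | m <;> rfl
  right_inv x := by rcases x with ⟨x | m, hx⟩ <;> rfl

theorem _root_.Matrix.det_fromBlocks_smul_one {m n : Type*} [Fintype m] [DecidableEq m]
    [Fintype n] [DecidableEq n] (A : Matrix m m K) (B : Matrix m n K) (C : Matrix n m K)
    {c : K} (hc : c ≠ 0) :
    (Matrix.fromBlocks A B C (c • 1)).det =
      c ^ Fintype.card n * (A - c⁻¹ • (B * C)).det := by
  let _ : Invertible (c • (1 : Matrix n n K)) :=
    ⟨c⁻¹ • 1, by rw [Matrix.smul_mul, Matrix.one_mul, smul_smul, inv_mul_cancel₀ hc, one_smul],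
      by rw [Matrix.smul_mul, Matrix.one_mul, smul_smul, mul_inv_cancel₀ hc, one_smul]⟩
  rw [Matrix.det_fromBlocks₂₂]
  have : ⅟(c • (1 : Matrix n n K)) = c⁻¹ • 1 := rfl
  rw [this]
  simp

/-- Elimination of the vertices that the replacement rules add. -/
theorem netDet_replace (G : ABGraph) {t pa qa pb qb : K}
    (h : t - 2 * (pa - qa) - 2 * pb ≠ 0) :
    G.replace.netDet t pa qa pb qb =
      (t - 2 * (pa - qa) - 2 * pb) ^ Fintype.card G.A *
        G.netDet t (pb + qb ^ 2 / (t - 2 * (pa - qa) - 2 * pb))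
          (-(qb ^ 2 / (t - 2 * (pa - qa) - 2 * pb))) pa qa := by
  set c := t - 2 * (pa - qa) - 2 * pb with hc
  rw [netDet, ← Matrix.det_submatrix_equiv_self G.interiorReplaceEquiv]
  have hB : (Matrix.of fun u v : G.replace.Interior =>
      G.replace.netMatrix t pa qa pb qb u.1 v.1).submatrix G.interiorReplaceEquiv
        G.interiorReplaceEquiv =
      Matrix.fromBlocks
        (Matrix.of fun x y : G.Interior =>
          (if x.1 = y.1 then t else 0) - ∑ e, edgeForm pa qa (G.bEnds e) x.1 y.1 -
            ∑ e, pb *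
              ((if x.1 = (G.aEnds e).1 then 1 else 0) * (if y.1 = (G.aEnds e).1 then 1 else 0) +
              (if x.1 = (G.aEnds e).2 then 1 else 0) * (if y.1 = (G.aEnds e).2 then 1 else 0)))
        (Matrix.of fun (x : G.Interior) (m : G.A) => qb *
          ((if x.1 = (G.aEnds m).1 then 1 else 0) + (if x.1 = (G.aEnds m).2 then 1 else 0)))
        (Matrix.of fun (m : G.A) (x : G.Interior) => qb *
          ((if x.1 = (G.aEnds m).1 then 1 else 0) + (if x.1 = (G.aEnds m).2 then 1 else 0)))
        (c • 1) := by
    ext i j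
    rcases i with x | m <;> rcases j with y | m'
    · exact G.netMatrix_replace_inl_inl ..
    · exact G.netMatrix_replace_inl_inr ..
    · exact (G.replace.netMatrix_comm ..).trans (G.netMatrix_replace_inl_inr ..)
    · refine (G.netMatrix_replace_inr_inr ..).trans ?_
      simp [Matrix.one_apply, hc]
  rw [hB, Matrix.det_fromBlocks_smul_one _ _ _ h, netDet]
  congr 2
  ext x y
  simp only [Matrix.sub_apply, Matrix.smul_apply, Matrix.mul_apply, Matrix.of_apply,
    netMatrix, smul_eq_mul, Finset.mul_sum]
  -- The Schur correction is a sum over `a`-edges, one rank-one term per middle vertex; merged with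
  -- the `pb`-terms of the same edge it is again an `edgeForm`.
  rw [sub_sub, sub_sub, sub_sub, ← Finset.sum_add_distrib,
    add_comm (∑ e, edgeForm pa qa (G.bEnds e) x.1 y.1)]
  congr 2
  refine Finset.sum_congr rfl fun e _ => ?_
  simp only [edgeForm]
  ring

end ABGraph

theorem basilicaG_zero_netDet (t pa qa pb qb : K) :
    (basilicaG 0).netDet t pa qa pb qb = 1 := by
  have : IsEmpty (basilicaG 0).Interior := ⟨fun x => x.2 x.1 rfl⟩
  exact Matrix.det_isEmpty

/-- The elimination divides by pivots, so it takes place over the rational functions, at `t =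
RatFunc.X`. -/
theorem map_basilicaC (n : ℕ) :
    algebraMap ℝ[X] (RatFunc ℝ) (basilicaC n) =
      (basilicaG n).netDet (RatFunc.X : RatFunc ℝ) 1 1 1 1 := by
  rw [basilicaC, Matrix.charpoly, RingHom.map_det, ABGraph.netDet]
  congr 1
  ext u v
  simp only [RingHom.mapMatrix_apply, Matrix.map_apply, Matrix.charmatrix_apply, Matrix.of_apply,
    ABGraph.netMatrix_one, ABGraph.dirichletLaplacian, ABGraph.laplacian, Matrix.submatrix_apply,
    Matrix.sub_apply, Matrix.diagonal_apply, map_sub, Subtype.val_inj]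
  by_cases h : u = v <;> simp [h]

theorem basilicaC_monic (n : ℕ) : (basilicaC n).Monic := Matrix.charpoly_monic _

theorem card_basilicaG_A_succ_succ (n : ℕ) :
    Fintype.card (basilicaG (n + 2)).A =
      Fintype.card (basilicaG (n + 1)).A + 2 * Fintype.card (basilicaG n).A := by
  have hA (G : ABGraph) : Fintype.card G.replace.A = Fintype.card G.B + Fintype.card G.A :=
    Fintype.card_sum
  have hB (G : ABGraph) : Fintype.card G.replace.B = Fintype.card G.A * 2 := by
    exact (Fintype.card_prod _ _).trans (by simp)
  change Fintype.card (basilicaG n).replace.replace.A =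
    Fintype.card (basilicaG n).replace.A + 2 * Fintype.card (basilicaG n).A
  rw [hA (basilicaG n).replace, hB]
  ring

theorem card_basilicaG_zero_A : Fintype.card (basilicaG 0).A = 1 := rfl

theorem card_basilicaG_one_A : Fintype.card (basilicaG 1).A = 1 := rfl

end Network

/-! ### The recursive system, its zeros, and the elimination parameters. -/

section System

/-- Sequences `g`, `r`, `d` that satisfy the recursion of the numerators `γ_n` (`g n`), of the
denominator factors `η_{n+1} / γ_n` (`r n`, up to the sign for `n ≤ 1`) and of the quotients
`(γ_{n+2} + 2 η_{n+2}) / γ_n` (`d n`). -/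
structure IsBasilicaSystem {R : Type*} [CommRing R] (g r d : ℕ → R) : Prop where
  g_zero : g 0 = 1
  r_zero : r 0 = -1
  r_one : r 1 = -1
  d_zero : d 0 = g 1 ^ 2 - 4 * g 1 - 4
  g_rec : ∀ n, g (n + 2) = d n * g n - 2 * g (n + 1) * r (n + 1)
  r_rec : ∀ n, r (n + 2) = g n * r n ^ 2
  d_rec : ∀ n, d (n + 1) = d n * g (n + 1) - 8 * r (n + 2) * r (n + 1)

namespace IsBasilicaSystem

theorem map {R S : Type*} [CommRing R] [CommRing S] {g r d : ℕ → R}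
    (h : IsBasilicaSystem g r d) (φ : R →+* S) :
    IsBasilicaSystem (fun n => φ (g n)) (fun n => φ (r n)) (fun n => φ (d n)) where
  g_zero := by simp [h.g_zero]
  r_zero := by simp [h.r_zero]
  r_one := by simp [h.r_one]
  d_zero := by simp [h.d_zero, map_ofNat]
  g_rec n := by simp [h.g_rec, map_ofNat]
  r_rec n := by simp [h.r_rec]
  d_rec n := by simp [h.d_rec, map_ofNat]

section Ring

variable {R : Type*} [CommRing R] {g r d : ℕ → R} (h : IsBasilicaSystem g r d)
include h

theorem g_two : g 2 = g 1 ^ 2 - 2 * g 1 - 4 := by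
  have := h.g_rec 0
  simp only [zero_add, h.g_zero, h.d_zero, h.r_one] at this
  rw [this]; ring

/-- This is the ζ-recursion with denominators cleared; it needs no non-vanishing. -/
theorem g_add_three (n : ℕ) : g (n + 3) =
    2 * g (n + 2) * r (n + 2) + d n * (g (n + 1) ^ 2 - 4 * (g n * r n) ^ 2) := by
  linear_combination h.g_rec (n + 1) + g (n + 1) * h.d_rec n - 4 * r (n + 2) * h.g_rec n -
    4 * d n * g n * h.r_rec n

end Ring

section Field

variable {F : Type*} [Field F] {g r d : ℕ → F} (h : IsBasilicaSystem g r d)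
include h

theorem r_ne_zero {n : ℕ} (hg : ∀ j, j + 2 ≤ n → g j ≠ 0) : r n ≠ 0 := by
  induction n using Nat.strong_induction_on with
  | _ n ih =>
    match n, hg, ih with
    | 0, _, _ => simp [h.r_zero]
    | 1, _, _ => simp [h.r_one]
    | n + 2, hg, ih =>
      rw [h.r_rec]
      exact mul_ne_zero (hg n le_rfl)
        (pow_ne_zero _ (ih n (by omega) fun j hj => hg j (by omega)))

/-- Used where `g (n + 1)` vanishes for the first time: it then forces `g (n + 2) ≠ 0`. -/
theorem exists_mul_eq_sq_sub (n : ℕ) (hg : ∀ j < n, g j ≠ 0) :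
    ∃ t : F, t ≠ 0 ∧
      t * (g (n + 2) - 2 * g (n + 1) * r (n + 1)) = g (n + 1) ^ 2 - 4 * (g n * r n) ^ 2 := by
  induction n with
  | zero =>
    refine ⟨1, one_ne_zero, ?_⟩
    simp only [zero_add, h.g_two, h.r_one, h.g_zero, h.r_zero]
    ring
  | succ n ih =>
    obtain ⟨t, ht, e⟩ := ih fun j hj => hg j (by omega)
    -- The next difference of squares factors: the plus factor is `g n * d n` by `g_rec`, and the
    -- minus factor enters through `g_add_three` and the induction hypothesis.
    refine ⟨g n / t, div_ne_zero (hg n (by omega)) ht, ?_⟩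
    rw [div_mul_eq_mul_div, div_eq_iff ht, h.g_add_three]
    linear_combination (-(g n * d n)) * e -
      t * (g (n + 2) - 2 * g (n + 1) * r (n + 1)) * h.g_rec n

variable [CharZero F]

/-- After the first zero, the sequence `g` has no other one. -/
theorem g_ne_zero_of_eq_zero {k m : ℕ} (hk : g k = 0) (hg : ∀ j < k, g j ≠ 0) (hm : k < m) :
    g m ≠ 0 := by
  obtain _ | n := k
  · simp [h.g_zero] at hk
  have hn : g n ≠ 0 := hg n (by omega)
  have hr0 : r n ≠ 0 := h.r_ne_zero fun j hj => hg j (by omega)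
  have hr1 : r (n + 1) ≠ 0 := h.r_ne_zero fun j hj => hg j (by omega)
  have hr2 : r (n + 2) ≠ 0 := h.r_ne_zero fun j hj => hg j (by omega)
  have hg2 : g (n + 2) ≠ 0 := by
    obtain ⟨t, ht, e⟩ := h.exists_mul_eq_sq_sub n fun j hj => hg j (by omega)
    intro h0
    rw [h0, hk] at e
    have : (4 : F) * (g n * r n) ^ 2 = 0 := by linear_combination e
    simp [hn, hr0] at this
  -- Beyond the zero at `n + 1`, `r` vanishes at every second index, which makes the recursions for
  -- `d` and for every second `g` pure products. The last clause says that z = ±2 there, which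
  -- removes the `d`-term from `g_add_three` at the following step.
  have key : ∀ i, g (n + 2 * i + 2) ≠ 0 ∧ g (n + 2 * i + 3) ≠ 0 ∧ d (n + 2 * i + 1) ≠ 0 ∧
      r (n + 2 * i + 2) ≠ 0 ∧ r (n + 2 * i + 3) = 0 ∧
      g (n + 2 * i + 3) ^ 2 = 4 * (g (n + 2 * i + 2) * r (n + 2 * i + 2)) ^ 2 := by
    intro i
    induction i with
    | zero =>
      have hg3 : g (n + 3) = -2 * g (n + 2) * r (n + 2) := by
        have := h.g_rec (n + 1)
        rw [hk] at this
        linear_combination this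
      have hd : d (n + 1) = -8 * r (n + 2) * r (n + 1) := by
        have := h.d_rec n
        rw [hk] at this
        linear_combination this
      refine ⟨hg2, ?_, ?_, hr2, ?_, ?_⟩
      · rw [mul_zero, add_zero, hg3]; simp [hg2, hr2]
      · rw [mul_zero, add_zero, hd]; simp [hr1, hr2]
      · rw [mul_zero, add_zero, h.r_rec (n + 1), hk, zero_mul]
      · rw [mul_zero, add_zero, hg3]; ring
    | succ i ih =>
      rw [show n + 2 * (i + 1) = n + 2 * i + 2 by ring]
      generalize n + 2 * i = a at ih ⊢
      obtain ⟨h2, h3, hd, hr, hr', hsq⟩ := ih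
      have r4 : r (a + 4) = g (a + 2) * r (a + 2) ^ 2 := h.r_rec (a + 2)
      have r5 : r (a + 5) = 0 := by rw [h.r_rec (a + 3), hr']; ring
      have d2 : d (a + 2) = d (a + 1) * g (a + 2) := by rw [h.d_rec (a + 1), hr']; ring
      have d3 : d (a + 3) = d (a + 2) * g (a + 3) := by
        rw [h.d_rec (a + 2), show r (a + 2 + 2) = r (a + 4) from rfl,
          show r (a + 2 + 1) = r (a + 3) from rfl, hr']; ring
      have g4 : g (a + 4) = d (a + 2) * g (a + 2) := by
        rw [h.g_rec (a + 2), show r (a + 2 + 1) = r (a + 3) from rfl, hr']; ring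
      have g5 : g (a + 5) = 2 * g (a + 4) * r (a + 4) := by
        rw [h.g_add_three (a + 2), show g (a + 2 + 1) = g (a + 3) from rfl, hsq]; ring
      have hr4 : r (a + 4) ≠ 0 := by rw [r4]; exact mul_ne_zero h2 (pow_ne_zero _ hr)
      have hd2 : d (a + 2) ≠ 0 := by rw [d2]; exact mul_ne_zero hd h2
      have hg4 : g (a + 4) ≠ 0 := by rw [g4]; exact mul_ne_zero hd2 h2
      refine ⟨hg4, ?_, ?_, hr4, r5, ?_⟩
      · change g (a + 5) ≠ 0
        rw [g5]; exact mul_ne_zero (mul_ne_zero two_ne_zero hg4) hr4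
      · change d (a + 3) ≠ 0
        rw [d3]; exact mul_ne_zero hd2 h3
      · change g (a + 5) ^ 2 = 4 * (g (a + 4) * r (a + 4)) ^ 2
        rw [g5]; ring
  obtain ⟨i, hi⟩ : ∃ i, m = n + 2 * i + 2 ∨ m = n + 2 * i + 3 := ⟨(m - n - 2) / 2, by omega⟩
  obtain rfl | rfl := hi
  · exact (key i).1
  · exact (key i).2.1

theorem not_both_eq_zero {k m : ℕ} (hkm : k < m) : g k ≠ 0 ∨ g m ≠ 0 := by
  classical
  by_contra! hcon
  have hex : ∃ j, g j = 0 := ⟨k, hcon.1⟩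
  have hle : Nat.find hex ≤ k := Nat.find_min' hex hcon.1
  exact h.g_ne_zero_of_eq_zero (Nat.find_spec hex) (fun j hj => Nat.find_min hex hj)
    (hle.trans_lt hkm) hcon.2

/-- The constant z = 2 solves the ζ-recursion. This is the case λ = 0 and shows that no γ_n is the
zero polynomial. -/
theorem g_ne_zero_of_g_one (h1 : g 1 = -2) (n : ℕ) : g n ≠ 0 := by
  have key : ∀ n, g n ≠ 0 ∧ g (n + 1) = 2 * (g n * r n) := by
    intro n
    induction n using Nat.strong_induction_on with
    | _ n ih =>
      match n, ih with
      | 0, _ => simp [h.g_zero, h.r_zero, h1]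
      | 1, _ =>
        refine ⟨by simp [h1], ?_⟩
        rw [h.g_two, h.r_one, h1]; norm_num
      | n + 2, ih =>
        obtain ⟨hg1, e1⟩ := ih (n + 1) (by omega)
        have hr : r (n + 1) ≠ 0 := h.r_ne_zero fun j hj => (ih j (by omega)).1
        refine ⟨?_, ?_⟩
        · rw [e1]; exact mul_ne_zero two_ne_zero (mul_ne_zero hg1 hr)
        · rw [h.g_add_three, (ih n (by omega)).2]; ring
  exact (key n).1

end Field

/-! ### Elimination parameters -/

section Elimination

variable {F : Type*} [Field F]

/-- The off-diagonal parameters of the two-terminal elements met in the elimination. -/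
def offDiag (g r : ℕ → F) : ℕ → F
  | 0 => 1
  | 1 => 1
  | n + 2 => offDiag g r n / (g (n + 1) / (g n * r n))

/-- The diagonal parameters of the two-terminal elements met in the elimination. -/
def onDiag (g r : ℕ → F) : ℕ → F
  | 0 => 1
  | 1 => 1
  | n + 2 => onDiag g r n - offDiag g r (n + 2)

/-- The pivots of the elimination. -/
def pivot (g r : ℕ → F) (n : ℕ) : F := -(g (n + 1) / (g n * r n)) * offDiag g r n

variable {g r d : ℕ → F} (h : IsBasilicaSystem g r d) (hg : ∀ n, g n ≠ 0)
include h hg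

theorem r_ne_zero' (n : ℕ) : r n ≠ 0 := h.r_ne_zero fun j _ => hg j

theorem offDiag_ne_zero (n : ℕ) : offDiag g r n ≠ 0 := by
  induction n using Nat.strong_induction_on with
  | _ n ih =>
    match n, ih with
    | 0, _ => exact one_ne_zero
    | 1, _ => exact one_ne_zero
    | n + 2, ih =>
      exact div_ne_zero (ih n (by omega)) (div_ne_zero (hg _)
        (mul_ne_zero (hg _) (h.r_ne_zero' hg _)))

theorem pivot_ne_zero (n : ℕ) : pivot g r n ≠ 0 :=
  mul_ne_zero (neg_ne_zero.2 (div_ne_zero (hg _) (mul_ne_zero (hg _) (h.r_ne_zero' hg _))))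
    (h.offDiag_ne_zero hg n)

/-- The recursion of the rational functions `ζ_n`, here `g (n + 1) / (g n * r n)`. -/
theorem zeta_rec (n : ℕ) : g (n + 3) / (g (n + 2) * r (n + 2)) - 2 =
    (1 + 2 / (g (n + 2) / (g (n + 1) * r (n + 1)))) * ((g (n + 1) / (g n * r n)) ^ 2 - 4) := by
  have h0 := hg n
  have h1 := hg (n + 1)
  have h2 := hg (n + 2)
  have k0 := h.r_ne_zero' hg n
  have k1 := h.r_ne_zero' hg (n + 1)
  have hG := h.g_rec n
  have hd : d n = (g (n + 2) + 2 * g (n + 1) * r (n + 1)) / g n := by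
    rw [hG]; field_simp; ring
  rw [h.g_add_three, h.r_rec, hd]
  field_simp
  ring

/-- A first integral of the ζ-recursion: one step of the recursion multiplies both sides by the same
factor. -/
theorem zeta_mul_offDiag (n : ℕ) :
    (g (n + 2) / (g (n + 1) * r (n + 1)) - 2) * offDiag g r (n + 1) =
      offDiag g r n * ((g (n + 1) / (g n * r n)) ^ 2 - 4) / (g (n + 1) / (g n * r n)) := by
  induction n with
  | zero =>
    have h1 := hg 1
    simp only [zero_add, offDiag, h.g_zero, h.r_zero, h.r_one, h.g_two]
    field_simp
    ring
  | succ n ih =>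
    rw [h.zeta_rec hg n]
    have z2 : g (n + 2) / (g (n + 1) * r (n + 1)) ≠ 0 :=
      div_ne_zero (hg _) (mul_ne_zero (hg _) (h.r_ne_zero' hg _))
    have z1 : g (n + 1) / (g n * r n) ≠ 0 :=
      div_ne_zero (hg _) (mul_ne_zero (hg _) (h.r_ne_zero' hg _))
    change _ * (offDiag g r n / (g (n + 1) / (g n * r n))) =
      offDiag g r (n + 1) * ((g (n + 2) / (g (n + 1) * r (n + 1))) ^ 2 - 4) /
        (g (n + 2) / (g (n + 1) * r (n + 1)))
    generalize g (n + 2) / (g (n + 1) * r (n + 1)) = a at *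
    generalize g (n + 1) / (g n * r n) = b at *
    field_simp at ih ⊢
    linear_combination -(a + 2) * ih

/-- Matches the explicit pivots with those of `netDet_replace`. On the right, consecutive values
differ by 4 Q_{n+2} - 2 Q_{n+1}, and `zeta_mul_offDiag` gives the same difference on the left. -/
theorem pivot_eq {t : F} (ht : g 1 = t - 2) (n : ℕ) : pivot g r n =
    t - 2 * (onDiag g r (n + 1) - offDiag g r (n + 1)) - 2 * onDiag g r n := by
  induction n with
  | zero => simp [pivot, onDiag, offDiag, h.g_zero, h.r_zero, ht, div_neg]
  | succ n ih =>
    have e := h.zeta_mul_offDiag hg n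
    have z1 : g (n + 1) / (g n * r n) ≠ 0 :=
      div_ne_zero (hg _) (mul_ne_zero (hg _) (h.r_ne_zero' hg _))
    have hp : onDiag g r (n + 1 + 1) = onDiag g r n - offDiag g r (n + 2) := rfl
    have hq : offDiag g r (n + 2) = offDiag g r n / (g (n + 1) / (g n * r n)) := rfl
    rw [hp, show offDiag g r (n + 1 + 1) = offDiag g r (n + 2) from rfl, hq]
    simp only [pivot] at ih ⊢
    generalize g (n + 1) / (g n * r n) = b at *
    change -(g (n + 2) / (g (n + 1) * r (n + 1))) * _ = _
    generalize g (n + 2) / (g (n + 1) * r (n + 1)) = a at *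
    have e' : offDiag g r n * (b ^ 2 - 4) / b =
        offDiag g r n * b - 4 * (offDiag g r n / b) := by field_simp
    linear_combination ih - e - e'

theorem sq_div_pivot (n : ℕ) : offDiag g r n ^ 2 / pivot g r n = -offDiag g r (n + 2) := by
  have := h.offDiag_ne_zero hg n
  have z1 : g (n + 1) / (g n * r n) ≠ 0 :=
      div_ne_zero (hg _) (mul_ne_zero (hg _) (h.r_ne_zero' hg _))
  simp only [pivot, offDiag]
  generalize g (n + 1) / (g n * r n) = b at *
  field_simp

theorem netDet_succ {t : F} (ht : g 1 = t - 2) (n j : ℕ) :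
    (basilicaG (n + 1)).netDet t (onDiag g r (j + 1)) (offDiag g r (j + 1)) (onDiag g r j)
        (offDiag g r j) =
      pivot g r j ^ Fintype.card (basilicaG n).A *
        (basilicaG n).netDet t (onDiag g r (j + 2)) (offDiag g r (j + 2)) (onDiag g r (j + 1))
          (offDiag g r (j + 1)) := by
  have hp := h.pivot_ne_zero hg j
  rw [h.pivot_eq hg ht] at hp
  refine (ABGraph.netDet_replace (basilicaG n) hp).trans ?_
  rw [← h.pivot_eq hg ht, h.sq_div_pivot hg, neg_neg, ← sub_eq_add_neg]
  rfl

/-- The exponents of the pivots are numbers of `a`-edges, which satisfy a_{n+2} = a_{n+1} + 2 a_n;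
so all pivots but the last are absorbed by the earlier determinants. -/
theorem netDet_succ_succ {t : F} (ht : g 1 = t - 2) (n j : ℕ) :
    (basilicaG (n + 2)).netDet t (onDiag g r (j + 1)) (offDiag g r (j + 1)) (onDiag g r j)
        (offDiag g r j) =
      pivot g r (j + n + 1) *
        (basilicaG (n + 1)).netDet t (onDiag g r (j + 1)) (offDiag g r (j + 1)) (onDiag g r j)
          (offDiag g r j) *
        (basilicaG n).netDet t (onDiag g r (j + 1)) (offDiag g r (j + 1)) (onDiag g r j)
          (offDiag g r j) ^ 2 := by
  induction n generalizing j with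
  | zero =>
    simp only [h.netDet_succ hg ht, basilicaG_zero_netDet, zero_add, card_basilicaG_zero_A,
      card_basilicaG_one_A]
    ring_nf
  | succ n ih =>
    rw [h.netDet_succ hg ht (n + 2), ih, h.netDet_succ hg ht (n + 1) j, h.netDet_succ hg ht n j,
      card_basilicaG_A_succ_succ, show j + (n + 1) + 1 = j + 1 + n + 1 by ring]
    ring

end Elimination

end IsBasilicaSystem

end System

/-! ### Uniqueness and construction of γ, then η and ζ. -/

section GammaSequence

/-- `f` is a product of powers of `γ 1, …, γ (n - 1)`. -/
def IsGammaProd (γ : ℕ → ℝ[X]) (n : ℕ) (f : ℝ[X]) : Prop :=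
  ∃ s : ℕ → ℕ, f = ∏ k ∈ Finset.Ico 1 n, γ k ^ s k

namespace IsGammaProd

variable {γ : ℕ → ℝ[X]} {n m : ℕ} {f f' : ℝ[X]}

theorem one : IsGammaProd γ n 1 := ⟨0, by simp⟩

theorem mul (h : IsGammaProd γ n f) (h' : IsGammaProd γ n f') : IsGammaProd γ n (f * f') := by
  obtain ⟨s, rfl⟩ := h
  obtain ⟨s', rfl⟩ := h'
  exact ⟨s + s', by simp [pow_add, Finset.prod_mul_distrib]⟩

theorem mono (h : IsGammaProd γ n f) (hnm : n ≤ m) : IsGammaProd γ m f := by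
  obtain ⟨s, rfl⟩ := h
  refine ⟨fun k => if k < n then s k else 0, ?_⟩
  rw [← Finset.prod_subset (Finset.Ico_subset_Ico_right hnm)]
  · exact Finset.prod_congr rfl fun k hk => by simp [(Finset.mem_Ico.1 hk).2]
  · intro k hk hk'
    have hkn : ¬ k < n := fun h => hk' (Finset.mem_Ico.2 ⟨(Finset.mem_Ico.1 hk).1, h⟩)
    simp [hkn]

theorem self (h0 : γ 0 = 1) {k : ℕ} (hk : k < n) : IsGammaProd γ n (γ k) := by
  obtain rfl | hk0 := Nat.eq_zero_or_pos k
  · rw [h0]; exact one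
  · refine ⟨fun i => if i = k then 1 else 0, ?_⟩
    rw [Finset.prod_eq_single_of_mem k (Finset.mem_Ico.2 ⟨hk0, hk⟩)]
    · simp
    · intro i _ hi; simp [hi]

end IsGammaProd

namespace IsGammaSeq

variable {γ γ' : ℕ → ℝ[X]}

theorem monic (h : IsGammaSeq γ) (n : ℕ) : (γ n).Monic := by
  induction n using Nat.strong_induction_on with
  | _ n ih =>
    obtain rfl | hn := Nat.eq_zero_or_pos n
    · rw [h.1]; exact monic_one
    · obtain ⟨s, hs⟩ := (h.2 n hn).2
      have hc := basilicaC_monic n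
      rw [hs] at hc
      exact (monic_prod_of_monic _ _ fun k hk =>
        (ih k (Finset.mem_Ico.1 hk).2).pow _).of_mul_monic_right hc

/-- By induction the earlier factors agree, so each new factor is coprime to the other's cofactor.
The two divide each other and, being monic, coincide. -/
theorem unique (h : IsGammaSeq γ) (h' : IsGammaSeq γ') : γ = γ' := by
  funext n
  induction n using Nat.strong_induction_on with
  | _ n ih =>
    obtain rfl | hn := Nat.eq_zero_or_pos n
    · rw [h.1, h'.1]
    · obtain ⟨hcop, s, hs⟩ := h.2 n hn
      obtain ⟨hcop', s', hs'⟩ := h'.2 n hn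
      have hdvd : γ n ∣ γ' n :=
        (IsCoprime.prod_right fun k hk => by
          rw [← ih k (Finset.mem_Ico.1 hk).2]
          exact (hcop k (Finset.mem_Ico.1 hk).2).pow_right).dvd_of_dvd_mul_right
          (hs' ▸ hs ▸ dvd_mul_right _ _ : γ n ∣ γ' n * ∏ k ∈ Finset.Ico 1 n, γ' k ^ s' k)
      have hdvd' : γ' n ∣ γ n :=
        (IsCoprime.prod_right fun k hk => by
          rw [ih k (Finset.mem_Ico.1 hk).2]
          exact (hcop' k (Finset.mem_Ico.1 hk).2).pow_right).dvd_of_dvd_mul_right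
          (hs ▸ hs' ▸ dvd_mul_right _ _ : γ' n ∣ γ n * ∏ k ∈ Finset.Ico 1 n, γ k ^ s k)
      exact eq_of_monic_of_associated (h.monic n) (h'.monic n)
        (associated_of_dvd_dvd hdvd hdvd')

end IsGammaSeq

/-- The terms `g n, g (n + 1), r n, r (n + 1), d n` of the basilica system. -/
structure BasilicaState where
  g₀ : ℝ[X]
  g₁ : ℝ[X]
  r₀ : ℝ[X]
  r₁ : ℝ[X]
  d : ℝ[X]

/-- The sequence of states of the basilica system. -/
noncomputable def basilicaState : ℕ → BasilicaState
  | 0 => ⟨1, X - 2, -1, -1, (X - 2) ^ 2 - 4 * (X - 2) - 4⟩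
  | n + 1 =>
    let s := basilicaState n
    ⟨s.g₁, s.d * s.g₀ - 2 * s.g₁ * s.r₁, s.r₁, s.g₀ * s.r₀ ^ 2,
      s.d * s.g₁ - 8 * (s.g₀ * s.r₀ ^ 2) * s.r₁⟩

/-- The polynomials `γ_n`. -/
noncomputable def basilicaGamma (n : ℕ) : ℝ[X] := (basilicaState n).g₀

/-- The polynomials `η_{n+1} / γ_n` (with the sign changed for `n ≤ 1`). -/
noncomputable def basilicaRho (n : ℕ) : ℝ[X] := (basilicaState n).r₀

/-- The polynomials `(γ_{n+2} + 2 η_{n+2}) / γ_n`. -/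
noncomputable def basilicaDelta (n : ℕ) : ℝ[X] := (basilicaState n).d

theorem isBasilicaSystem :
    IsBasilicaSystem basilicaGamma basilicaRho basilicaDelta where
  g_zero := rfl
  r_zero := rfl
  r_one := rfl
  d_zero := rfl
  g_rec _ := rfl
  r_rec _ := rfl
  d_rec _ := rfl

theorem basilicaGamma_one : basilicaGamma 1 = X - 2 := rfl

theorem basilicaGamma_two : basilicaGamma 2 = X ^ 2 - 6 * X + 4 := by
  rw [isBasilicaSystem.g_two, basilicaGamma_one]; ring

theorem basilicaGamma_three :
    basilicaGamma 3 = X ^ 4 - 12 * X ^ 3 + 42 * X ^ 2 - 44 * X + 8 := by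
  have h := isBasilicaSystem
  rw [h.g_add_three, h.d_zero, h.r_rec, h.r_zero, h.g_zero, zero_add, zero_add, basilicaGamma_one,
    basilicaGamma_two]
  ring

theorem basilicaGamma_ne_zero (n : ℕ) : basilicaGamma n ≠ 0 := fun h0 =>
  (isBasilicaSystem.map (evalRingHom (0 : ℝ))).g_ne_zero_of_g_one
    (by simp [basilicaGamma_one]) n (by simp [h0])

theorem isCoprime_basilicaGamma {k m : ℕ} (hkm : k ≠ m) :
    IsCoprime (basilicaGamma k) (basilicaGamma m) := by
  rw [isCoprime_iff_aeval_ne_zero_of_isAlgClosed ℝ ℂ]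
  intro z
  have h := isBasilicaSystem.map (aeval (R := ℝ) z : ℝ[X] →ₐ[ℝ] ℂ).toRingHom
  rcases lt_or_gt_of_ne hkm with hlt | hlt
  · exact h.not_both_eq_zero hlt
  · exact (h.not_both_eq_zero hlt).symm

theorem isBasilicaSystem_ratFunc :
    IsBasilicaSystem (fun n => algebraMap ℝ[X] (RatFunc ℝ) (basilicaGamma n))
      (fun n => algebraMap ℝ[X] (RatFunc ℝ) (basilicaRho n))
      (fun n => algebraMap ℝ[X] (RatFunc ℝ) (basilicaDelta n)) :=
  isBasilicaSystem.map (algebraMap ℝ[X] (RatFunc ℝ))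

theorem algebraMap_basilicaGamma_ne_zero (n : ℕ) :
    algebraMap ℝ[X] (RatFunc ℝ) (basilicaGamma n) ≠ 0 :=
  RatFunc.algebraMap_ne_zero (basilicaGamma_ne_zero n)

/-- The factorization of `c_n` cannot be inducted on alone, since the next pivot has `basilicaRho (n
+ 1)` in its denominator. The polynomial `u` records that Q_{n+1} `c_n` is divisible by it, with a
quotient of the same product form. -/
theorem exists_basilicaC_eq (n : ℕ) : ∃ κ u : ℝ[X], IsGammaProd basilicaGamma n κ ∧
    IsGammaProd basilicaGamma (n + 1) u ∧ basilicaC n = basilicaGamma n * κ ∧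
    algebraMap ℝ[X] (RatFunc ℝ) (u * basilicaRho (n + 1)) =
      -IsBasilicaSystem.offDiag (fun n => algebraMap ℝ[X] (RatFunc ℝ) (basilicaGamma n))
        (fun n => algebraMap ℝ[X] (RatFunc ℝ) (basilicaRho n)) (n + 1) *
          algebraMap ℝ[X] (RatFunc ℝ) (basilicaC n) := by
  have h := isBasilicaSystem_ratFunc
  have hg := algebraMap_basilicaGamma_ne_zero
  have ht : algebraMap ℝ[X] (RatFunc ℝ) (basilicaGamma 1) = RatFunc.X - 2 := by
    simp [basilicaGamma_one, map_ofNat]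
  have hr := h.r_ne_zero' hg
  have hinj := RatFunc.algebraMap_injective ℝ
  have hc0 : basilicaC 0 = 1 := hinj (by
    rw [map_basilicaC, basilicaG_zero_netDet, map_one])
  have hc1 : basilicaC 1 = basilicaGamma 1 := hinj (by
    have e := h.netDet_succ hg ht 0 0
    rw [basilicaG_zero_netDet, mul_one, card_basilicaG_zero_A, pow_one] at e
    rw [map_basilicaC]
    refine e.trans ?_
    simp [IsBasilicaSystem.pivot, IsBasilicaSystem.offDiag, isBasilicaSystem.g_zero,
      isBasilicaSystem.r_zero, div_neg])
  have hc2 (n : ℕ) : algebraMap ℝ[X] (RatFunc ℝ) (basilicaC (n + 2)) =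
      IsBasilicaSystem.pivot (fun n => algebraMap ℝ[X] (RatFunc ℝ) (basilicaGamma n))
        (fun n => algebraMap ℝ[X] (RatFunc ℝ) (basilicaRho n)) (n + 1) *
        algebraMap ℝ[X] (RatFunc ℝ) (basilicaC (n + 1)) *
        algebraMap ℝ[X] (RatFunc ℝ) (basilicaC n) ^ 2 := by
    have e := h.netDet_succ_succ hg ht n 0
    simp only [zero_add, IsBasilicaSystem.onDiag, IsBasilicaSystem.offDiag] at e
    simp only [map_basilicaC]
    exact e
  have h0 := isBasilicaSystem.g_zero
  induction n using Nat.strong_induction_on with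
  | _ n ih =>
    match n, ih with
    | 0, _ =>
      refine ⟨1, 1, .one, .one, by rw [hc0, h0, mul_one], ?_⟩
      simp [hc0, isBasilicaSystem.r_one, IsBasilicaSystem.offDiag]
    | 1, _ =>
      refine ⟨1, 1, .one, .one, by rw [hc1, mul_one], ?_⟩
      have := hg 1
      simp only [hc1, isBasilicaSystem.r_rec, IsBasilicaSystem.offDiag, h0,
        isBasilicaSystem.r_zero, zero_add, map_mul, map_neg, map_one, map_pow]
      field_simp
    | n + 2, ih =>
      obtain ⟨κ, u, hκ, hu, eκ, eu⟩ := ih n (by omega)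
      obtain ⟨κ', u', hκ', hu', eκ', eu'⟩ := ih (n + 1) (by omega)
      -- In pivot · c_{n+1} · c_n², one `c_n` cancels `basilicaRho (n + 1)` and leaves `u`, the
      -- other is `basilicaGamma n * κ`, and c_{n+1} cancels `basilicaGamma (n + 1)` and leaves
      -- `κ'`. For Q_{n+3} c_{n+2} the z-factors cancel, so both copies of `c_n` pair with Q_{n+1}
      -- and give `u ^ 2`.
      refine ⟨u * basilicaGamma n * κ * κ', u ^ 2 * κ', ?_, ?_, hinj ?_, ?_⟩
      · exact (((hu.mono (by omega)).mul (.self h0 (by omega))).mul (hκ.mono (by omega))).mul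
          (hκ'.mono (by omega))
      · rw [pow_two]
        exact ((hu.mono (by omega)).mul (hu.mono (by omega))).mul (hκ'.mono (by omega))
      · have g1 := hg (n + 1)
        have r1 := hr (n + 1)
        rw [eκ] at eu
        rw [hc2, eκ, eκ', IsBasilicaSystem.pivot]
        simp only [map_mul] at eu ⊢
        field_simp
        linear_combination -(algebraMap ℝ[X] (RatFunc ℝ) (basilicaGamma (n + 1 + 1)) *
          algebraMap ℝ[X] (RatFunc ℝ) κ' * algebraMap ℝ[X] (RatFunc ℝ) (basilicaGamma n) *
          algebraMap ℝ[X] (RatFunc ℝ) κ) * eu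
      · have g1 := hg (n + 1)
        have g2 := hg (n + 2)
        have r1 := hr (n + 1)
        rw [hc2, eκ', isBasilicaSystem.r_rec (n + 1), IsBasilicaSystem.pivot]
        simp only [map_mul, map_pow] at eu ⊢
        rw [IsBasilicaSystem.offDiag]
        generalize algebraMap ℝ[X] (RatFunc ℝ) (basilicaC n) = c at *
        field_simp
        generalize (IsBasilicaSystem.offDiag _ _ (n + 1) : RatFunc ℝ) = q at *
        linear_combination algebraMap ℝ[X] (RatFunc ℝ) κ' * (algebraMap ℝ[X] (RatFunc ℝ) u *
          algebraMap ℝ[X] (RatFunc ℝ) (basilicaRho (n + 1)) - q * c) * eu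

theorem isGammaSeq_basilicaGamma : IsGammaSeq basilicaGamma := by
  refine ⟨isBasilicaSystem.g_zero, fun n hn => ⟨fun k hk => isCoprime_basilicaGamma hk.ne', ?_⟩⟩
  obtain ⟨κ, u, ⟨s, rfl⟩, _, e, _⟩ := exists_basilicaC_eq n
  exact ⟨s, e⟩

/-- The factor `η_n / γ_{n-1}`. -/
noncomputable def etaProd (n : ℕ) : ℝ[X] :=
  ∏ j ∈ (Finset.range n).filter (fun j => 2 * j + 4 ≤ n), basilicaGamma (n - 2 * j - 3) ^ (2 ^ j)

/-- The factor with `j = 0` splits off; shifting `j` by one doubles the exponents of the rest, hence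
the square. -/
theorem etaProd_add_four (n : ℕ) :
    etaProd (n + 4) = basilicaGamma (n + 1) * etaProd (n + 2) ^ 2 := by
  have hf (m : ℕ) : (Finset.range m).filter (fun j => 2 * j + 4 ≤ m) =
      Finset.range (m / 2 - 1) := by
    ext j; simp only [Finset.mem_filter, Finset.mem_range]; omega
  rw [etaProd, etaProd, hf, hf, show (n + 4) / 2 - 1 = ((n + 2) / 2 - 1) + 1 by omega,
    Finset.prod_range_succ', ← Finset.prod_pow, mul_comm]
  congr 1
  · simp
  · refine Finset.prod_congr rfl fun j _ => ?_
    rw [← pow_mul, ← pow_succ, show n + 4 - 2 * (j + 1) - 3 = n + 2 - 2 * j - 3 by omega]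

theorem etaProd_two : etaProd 2 = 1 := by
  rw [etaProd, Finset.filter_false_of_mem fun j _ => by omega, Finset.prod_empty]

theorem etaProd_three : etaProd 3 = 1 := by
  rw [etaProd, Finset.filter_false_of_mem fun j _ => by omega, Finset.prod_empty]

/-- Both sides obey the same recursion. The signs of `r 0` and `r 1` disappear on squaring, so
agreement starts at `basilicaRho 2`. -/
theorem etaProd_add_three (n : ℕ) : etaProd (n + 3) = basilicaRho (n + 2) := by
  have h := isBasilicaSystem
  induction n using Nat.strong_induction_on with
  | _ n ih =>
    match n, ih with
    | 0, _ => rw [etaProd_three, h.r_rec, h.g_zero, h.r_zero]; ring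
    | 1, _ => rw [etaProd_add_four 0, etaProd_two, h.r_rec, h.r_one]; ring
    | n + 2, ih => rw [etaProd_add_four (n + 1), h.r_rec, ih n (by omega)]

theorem basilicaEta_add_three (n : ℕ) :
    basilicaEta basilicaGamma (n + 3) = basilicaGamma (n + 2) * basilicaRho (n + 2) := by
  rw [← etaProd_add_three]; rfl

theorem basilicaEta_two : basilicaEta basilicaGamma 2 = basilicaGamma 1 := by
  have : basilicaEta basilicaGamma 2 = basilicaGamma 1 * etaProd 2 := rfl
  rw [this, etaProd_two, mul_one]

theorem basilicaEta_ne_zero (n : ℕ) : basilicaEta basilicaGamma n ≠ 0 :=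
  mul_ne_zero (basilicaGamma_ne_zero _)
    (Finset.prod_ne_zero_iff.2 fun _ _ => pow_ne_zero _ (basilicaGamma_ne_zero _))

theorem isCoprime_basilicaEta {n : ℕ} (hn : 1 ≤ n) :
    IsCoprime (basilicaGamma n) (basilicaEta basilicaGamma n) :=
  (isCoprime_basilicaGamma (by omega)).mul_right
    (IsCoprime.prod_right fun _ _ => (isCoprime_basilicaGamma (by omega)).pow_right)

theorem RatFunc.isRootAt_div_iff {p q : ℝ[X]} (hq : q ≠ 0) (hpq : IsCoprime p q) (z : ℂ) :
    (algebraMap ℝ[X] (RatFunc ℝ) p / algebraMap ℝ[X] (RatFunc ℝ) q).IsRootAt z ↔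
      aeval z p = 0 := by
  set f := algebraMap ℝ[X] (RatFunc ℝ) p / algebraMap ℝ[X] (RatFunc ℝ) q with hf
  have e := congrArg (aeval z) ((RatFunc.num_mul_eq_mul_denom_iff hq).2 hf)
  rw [map_mul, map_mul] at e
  have h1 := (isCoprime_iff_aeval_ne_zero_of_isAlgClosed ℝ ℂ _ _).1 hpq z
  have h2 := (isCoprime_iff_aeval_ne_zero_of_isAlgClosed ℝ ℂ _ _).1 f.isCoprime_num_denom z
  constructor
  · rintro ⟨hn, hd⟩
    rw [hn, zero_mul] at e
    exact (mul_eq_zero.1 e.symm).resolve_right hd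
  · intro hp
    rw [hp, zero_mul] at e
    have hn := (mul_eq_zero.1 e).resolve_right (h1.resolve_left (not_not.2 hp))
    exact ⟨hn, h2.resolve_left (not_not.2 hn)⟩

theorem basilicaZeta_add_three (n : ℕ) : basilicaZeta basilicaGamma (n + 3) =
    algebraMap ℝ[X] (RatFunc ℝ) (basilicaGamma (n + 3)) /
      (algebraMap ℝ[X] (RatFunc ℝ) (basilicaGamma (n + 2)) *
        algebraMap ℝ[X] (RatFunc ℝ) (basilicaRho (n + 2))) := by
  rw [basilicaZeta, basilicaEta_add_three, map_mul]

/-- For `n = 0` the two bases differ in sign because `r 1 = -1`. Only the square of ζ_2 enters the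
recursion at index 4, which is why it already holds there. -/
theorem basilicaZeta_add_two_sq (n : ℕ) : basilicaZeta basilicaGamma (n + 2) ^ 2 =
    (algebraMap ℝ[X] (RatFunc ℝ) (basilicaGamma (n + 2)) /
      (algebraMap ℝ[X] (RatFunc ℝ) (basilicaGamma (n + 1)) *
        algebraMap ℝ[X] (RatFunc ℝ) (basilicaRho (n + 1)))) ^ 2 := by
  obtain _ | n := n
  · rw [basilicaZeta, zero_add, basilicaEta_two, isBasilicaSystem.r_one]
    simp [div_neg]
  · exact congrArg (· ^ 2) (basilicaZeta_add_three n)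

theorem basilicaZeta_rec {n : ℕ} (hn : 4 ≤ n) : basilicaZeta basilicaGamma n - 2 =
    (1 + 2 / basilicaZeta basilicaGamma (n - 1)) *
      (basilicaZeta basilicaGamma (n - 2) ^ 2 - 4) := by
  obtain ⟨m, rfl⟩ := Nat.exists_eq_add_of_le' hn
  change basilicaZeta basilicaGamma (m + 1 + 3) - 2 =
    (1 + 2 / basilicaZeta basilicaGamma (m + 3)) *
      (basilicaZeta basilicaGamma (m + 2) ^ 2 - 4)
  rw [basilicaZeta_add_two_sq, basilicaZeta_add_three, basilicaZeta_add_three]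
  exact isBasilicaSystem_ratFunc.zeta_rec algebraMap_basilicaGamma_ne_zero (m + 1)

end GammaSequence

theorem mainTheorem5 :
    (∃! γ : ℕ → ℝ[X], IsGammaSeq γ) ∧
    ∀ γ : ℕ → ℝ[X], IsGammaSeq γ →
      (∀ n, γ n ≠ 0) ∧ (∀ n, basilicaEta γ n ≠ 0) ∧
      (∀ n, 4 ≤ n →
        (∀ z : ℂ, (basilicaZeta γ n).IsRootAt z ↔ aeval z (γ n) = 0) ∧
        basilicaZeta γ n - 2 =
          (1 + 2 / basilicaZeta γ (n - 1)) * (basilicaZeta γ (n - 2) ^ 2 - 4)) ∧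
      basilicaZeta γ 2 = (RatFunc.X ^ 2 - 6 * RatFunc.X + 4) / (RatFunc.X - 2) ∧
      basilicaZeta γ 3 =
        (RatFunc.X ^ 4 - 12 * RatFunc.X ^ 3 + 42 * RatFunc.X ^ 2 - 44 * RatFunc.X + 8) /
          (RatFunc.X ^ 2 - 6 * RatFunc.X + 4) := by
  have hγ := isGammaSeq_basilicaGamma
  refine ⟨⟨basilicaGamma, hγ, fun γ h => h.unique hγ⟩, ?_⟩
  intro γ h
  obtain rfl := h.unique hγ
  refine ⟨basilicaGamma_ne_zero, basilicaEta_ne_zero, fun n hn => ⟨fun z => ?_,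
    basilicaZeta_rec hn⟩, ?_, ?_⟩
  · exact RatFunc.isRootAt_div_iff (basilicaEta_ne_zero n) (isCoprime_basilicaEta (by omega)) z
  · rw [basilicaZeta, basilicaEta_two, basilicaGamma_two, basilicaGamma_one]
    simp [map_ofNat]
  · rw [basilicaZeta, basilicaEta_add_three 0, ← etaProd_add_three, etaProd_three, mul_one, basilicaGamma_two, basilicaGamma_three]
    simp [map_ofNat]
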